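/- Let $X$ be a real Banach space. For an equivalent norm $\|\cdot\|$ on $X$ write $B$ and $S$ for the closed unit ball and the unit sphere of $(X,\|\cdot\|)$, and $S^*$ for the unit sphere of the dual $X^*$ in the dual norm of $\|\cdot\|$. A point $x\in S$ is called - an NSE (nicely strongly exposed) point of $S$ if for every $x^*\in S^*$ with $x^*(x)=1$ and every sequence $(x_n)_n$ in $B$ with $\lim_n x^*(x_n)=1$ one has $\|x_n-x\|\to 0$; - an aLUR (almost locally uniformly rotund) point of $S$ if $\|x_n-x\|\to 0$ for every pair of sequences $(x_n)_n$ in $S$ and $(x^*_m)_m$ in $S^*$ such that the limit $\alpha_m=\lim_n x^*_m\left(\frac{x_n+x}{2}\right)$ exists for every $m$ and $\lim_m\alpha_m=1$. Then $X$ is reflexive if and only if, for every equivalent norm $\|\cdot\|$ on $X$, the set of all aLUR points of the unit sphere of $(X,\|\cdot\|)$ coincides with the set of all NSE points of that sphere. -/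

import Mathlib

open Filter Topology

section Renorming

variable {X : Type*} [NormedAddCommGroup X] [NormedSpace ℝ X]

/-- The seminorm `p` is a norm on `X` that is equivalent to the given one. -/
def IsEquivalentNorm (p : Seminorm ℝ X) : Prop :=
  ∃ c C : ℝ, 0 < c ∧ 0 < C ∧ ∀ x : X, c * ‖x‖ ≤ p x ∧ p x ≤ C * ‖x‖

/-- The closed unit ball of `(X, p)`. -/
def unitBall (p : Seminorm ℝ X) : Set X := {x | p x ≤ 1}

/-- The unit sphere of `(X, p)`. -/
def unitSphere (p : Seminorm ℝ X) : Set X := {x | p x = 1}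

/-- The dual norm `p*(f) = sup {|f x| : p x ≤ 1}`. For an equivalent norm `p`, the dual of
`(X, p)` is the dual `StrongDual ℝ X` of `X` as a vector space, and this supremum is over a
nonempty bounded set. -/
noncomputable def dualNorm (p : Seminorm ℝ X) (f : StrongDual ℝ X) : ℝ :=
  sSup ((fun x : X => |f x|) '' unitBall p)

/-- The unit sphere of the dual of `(X, p)`. -/
def dualUnitSphere (p : Seminorm ℝ X) : Set (StrongDual ℝ X) := {f | dualNorm p f = 1}

/-- The duality map: the functionals of dual norm one that support the unit ball of `(X, p)`
at `x`. -/
def dualityMap (p : Seminorm ℝ X) (x : X) : Set (StrongDual ℝ X) :=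
  {f | f ∈ dualUnitSphere p ∧ f x = 1}

/-- Convergence of the sequence `u` to `x` in the norm `p`. -/
def ConvergesTo (p : Seminorm ℝ X) (u : ℕ → X) (x : X) : Prop :=
  Tendsto (fun n => p (u n - x)) atTop (𝓝 0)

/-- `x` is strongly exposed by `f` in `(X, p)`. -/
def IsStronglyExposedBy (p : Seminorm ℝ X) (x : X) (f : StrongDual ℝ X) : Prop :=
  ∀ u : ℕ → X, (∀ n, u n ∈ unitBall p) → Tendsto (fun n => f (u n)) atTop (𝓝 1) →
    ConvergesTo p u x

/-- `x` is a nicely strongly exposed point of the unit sphere of `(X, p)`. -/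
def IsNSE (p : Seminorm ℝ X) (x : X) : Prop :=
  x ∈ unitSphere p ∧ ∀ f ∈ dualityMap p x, IsStronglyExposedBy p x f

/-- `x` is an almost locally uniformly rotund point of the unit sphere of `(X, p)`: whenever
`u` is a sequence in the sphere and `f` a sequence in the dual sphere for which all the inner
limits `α m = lim_n f m ((u n + x) / 2)` exist and `lim_m α m = 1`, then `u` converges to `x`. -/
def IsALUR (p : Seminorm ℝ X) (x : X) : Prop :=
  x ∈ unitSphere p ∧
    ∀ (u : ℕ → X) (f : ℕ → StrongDual ℝ X),
      (∀ n, u n ∈ unitSphere p) → (∀ m, f m ∈ dualUnitSphere p) →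
      (∃ α : ℕ → ℝ,
        (∀ m, Tendsto (fun n => f m ((1 / 2 : ℝ) • (u n + x))) atTop (𝓝 (α m))) ∧
        Tendsto α atTop (𝓝 1)) →
      ConvergesTo p u x

end Renorming

/-- A normed space is reflexive if its canonical embedding into the bidual is onto. -/
def IsReflexiveSpace (X : Type*) [NormedAddCommGroup X] [NormedSpace ℝ X] : Prop :=
  Function.Surjective (NormedSpace.inclusionInDoubleDual ℝ X)

/-!
In every equivalent norm an almost locally uniformly rotund point is nicely strongly exposed: take
the sequence of functionals constant.

If `X` is reflexive, let `x` be nicely strongly exposed and let `u`, `f` be sequences with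
`lim_m lim_n f m ((u n + x) / 2) = 1`. A weak-star cluster point `φ` of `f` supports the ball at `x`.
A weak limit `w` of `u` along an ultrafilter lies in the ball, and `f m w = lim_n f m (u n)` gives
`φ w = 1`, so `w = x` because `φ` exposes `x`. Hence `φ (u n)` tends to `1`, and `u` tends to `x`
since `φ` strongly exposes `x` (`IsReflexiveSpace.isALUR`).

If `X` is not reflexive, James' construction (`exists_triangular_of_not_isReflexiveSpace`) gives
bounded sequences with `g m (y n) = 1` for `m ≤ n` and `g m (y n) = 0` for `n < m`, where all `g m`
vanish at a chosen vector `e`. Fix `E` with `E e = 1`, let `P` be the projection onto `ker E` along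
`e`, and put `f m = a m • E + g m` with `a m` increasing to `1` and `u n = (e + P (y n)) / 2`. Then
`lim_m lim_n f m (u n) = 1`, while any functional `h` dominated by `ν = sup_m |f m|` with `h e = 1`
vanishes at `P (y n)`, since only finitely many `f m` see that vector and these are less than `1`
at `e`. So the supremum `τ` of all such `|h|` is `1 / 2` at most at `u n`, and for a small multiple
`ρ` of `‖P ·‖` the norm `max ν √(τ ^ 2 + ρ ^ 2)` is at most `1` at `u n`. It exceeds `ν` only by a
term of second order near `e`, so its supporting functionals at `e` are among the `h` above
(`mem_supportSet_of_le_exposingNorm`). Where such an `h` is close to `1` on the ball, so is `τ`,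
hence `ρ` is close to `0`: thus `e` is nicely strongly exposed (`isNSE_exposingNorm`). But `u n`
stays away from `e`, as `E (u n) = 1 / 2`, so `e` is not almost locally uniformly rotund.
-/

/-! ### Dual norms of equivalent seminorms -/

section EquivalentNorm

variable {X : Type*} [NormedAddCommGroup X] [NormedSpace ℝ X] {p : Seminorm ℝ X}

theorem IsEquivalentNorm.eq_zero (hp : IsEquivalentNorm p) {x : X} (hx : p x = 0) : x = 0 := by
  obtain ⟨c, C, hc, -, h⟩ := hp
  have h1 := (h x).1
  rw [hx] at h1
  exact norm_le_zero_iff.1 (nonpos_of_mul_nonpos_right h1 hc)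

theorem IsEquivalentNorm.continuous (hp : IsEquivalentNorm p) : Continuous p := by
  obtain ⟨c, C, -, hC, h⟩ := hp
  refine Seminorm.continuous_of_le (q := C.toNNReal • normSeminorm ℝ X) ?_ fun x => ?_
  · exact continuous_norm.const_smul C.toNNReal
  · refine (h x).2.trans_eq ?_
    simp [NNReal.smul_def, hC.le]

theorem IsEquivalentNorm.exists_abs_le (hp : IsEquivalentNorm p) (f : StrongDual ℝ X) :
    ∃ K, 0 ≤ K ∧ ∀ x, |f x| ≤ K * p x := by
  obtain ⟨c, C, hc, -, h⟩ := hp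
  refine ⟨‖f‖ / c, by positivity, fun x => ?_⟩
  calc |f x| ≤ ‖f‖ * ‖x‖ := f.le_opNorm x
    _ = ‖f‖ / c * (c * ‖x‖) := by field_simp
    _ ≤ ‖f‖ / c * p x := by gcongr; exact (h x).1

theorem dualNorm_le {f : StrongDual ℝ X} {K : ℝ} (h : ∀ x, p x ≤ 1 → |f x| ≤ K) :
    dualNorm p f ≤ K := by
  refine csSup_le ⟨|f 0|, 0, by simp [unitBall], rfl⟩ ?_
  rintro _ ⟨x, hx, rfl⟩
  exact h x hx

theorem IsEquivalentNorm.abs_le_dualNorm (hp : IsEquivalentNorm p) (f : StrongDual ℝ X) {x : X}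
    (hx : p x ≤ 1) : |f x| ≤ dualNorm p f := by
  obtain ⟨K, hK, h⟩ := hp.exists_abs_le f
  refine le_csSup ⟨K, ?_⟩ ⟨x, hx, rfl⟩
  rintro _ ⟨y, hy, rfl⟩
  exact (h y).trans (mul_le_of_le_one_right hK hy)

theorem IsEquivalentNorm.abs_le_of_dualNorm_le_one (hp : IsEquivalentNorm p) {f : StrongDual ℝ X}
    (hf : dualNorm p f ≤ 1) (x : X) : |f x| ≤ p x := by
  rcases (apply_nonneg p x).eq_or_lt' with h0 | h0
  · simp [hp.eq_zero h0]
  · have h1 := (hp.abs_le_dualNorm f (x := (p x)⁻¹ • x)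
      (by simp [map_smul_eq_mul, abs_of_pos h0, h0.ne'])).trans hf
    rw [map_smul, smul_eq_mul, abs_mul, abs_of_pos (inv_pos.2 h0), inv_mul_le_iff₀ h0] at h1
    simpa using h1

theorem dualNorm_smul_of_nonneg {c : ℝ} (hc : 0 ≤ c) (f : StrongDual ℝ X) :
    dualNorm p (c • f) = c * dualNorm p f := by
  unfold dualNorm
  rw [← smul_eq_mul, ← Real.sSup_smul_of_nonneg hc, ← Set.image_smul, Set.image_image]
  simp [abs_mul, abs_of_nonneg hc]

/-- For a constant sequence of functionals, the defining property of an almost locally uniformly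
rotund point is strong exposedness. -/
theorem IsALUR.isNSE {x : X} (hp : IsEquivalentNorm p) (hx : IsALUR p x) : IsNSE p x := by
  refine ⟨hx.1, fun f hf u hu hfu => ?_⟩
  have hle : ∀ z, |f z| ≤ p z := hp.abs_le_of_dualNorm_le_one hf.1.le
  have hpu : Tendsto (fun n => p (u n)) atTop (𝓝 1) :=
    tendsto_of_tendsto_of_tendsto_of_le_of_le hfu tendsto_const_nhds
      (fun n => (le_abs_self _).trans (hle _)) hu
  have hinv : Tendsto (fun n => (p (u n))⁻¹) atTop (𝓝 1) := by simpa using hpu.inv₀ one_ne_zero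
  -- The normalized sequence is replaced by `x` where `u n = 0`.
  let v : ℕ → X := fun n => if p (u n) = 0 then x else (p (u n))⁻¹ • u n
  have hv : ∀ᶠ n in atTop, v n = (p (u n))⁻¹ • u n := by
    filter_upwards [hpu.eventually_ne one_ne_zero] with n hn
    simp [v, hn]
  have hvx : ConvergesTo p v x := by
    refine hx.2 v (fun _ => f) (fun n => ?_) (fun _ => hf.1) ⟨fun _ => 1, fun _ => ?_,
      tendsto_const_nhds⟩
    · by_cases h : p (u n) = 0
      · simpa [v, h] using hx.1
      · simp [v, h, unitSphere, map_smul_eq_mul, abs_of_nonneg (apply_nonneg p (u n))]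
    · have h1 : Tendsto (fun n => (1 / 2 : ℝ) * ((p (u n))⁻¹ * f (u n) + f x)) atTop
          (𝓝 ((1 / 2 : ℝ) * (1 * 1 + f x))) :=
        ((hinv.mul hfu).add_const _).const_mul _
      rw [hf.2] at h1
      norm_num at h1
      refine h1.congr' ?_
      filter_upwards [hv] with n hn
      simp [hn, hf.2]
      ring
  have hlim : Tendsto (fun n => |1 - (p (u n))⁻¹| * p (u n) + p (v n - x)) atTop (𝓝 0) := by
    simpa using ((hinv.const_sub 1).abs.mul hpu).add hvx
  refine tendsto_of_tendsto_of_tendsto_of_le_of_le' tendsto_const_nhds hlim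
    (.of_forall fun n => apply_nonneg p _) ?_
  filter_upwards [hv] with n hn
  have : u n - x = (1 - (p (u n))⁻¹) • u n + (v n - x) := by rw [hn]; module
  rw [this]
  refine (map_add_le_add p _ _).trans_eq ?_
  rw [map_smul_eq_mul, Real.norm_eq_abs]

end EquivalentNorm

/-! ### Reflexive spaces -/

section Reflexive

/-- Banach–Alaoglu along an ultrafilter: bounded families of functionals converge pointwise. -/
theorem exists_tendsto_apply_of_norm_le {E : Type*} [NormedAddCommGroup E] [NormedSpace ℝ E]
    {ι : Type*} (U : Ultrafilter ι) (φ : ι → StrongDual ℝ E) {R : ℝ} (h : ∀ i, ‖φ i‖ ≤ R) :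
    ∃ ψ : StrongDual ℝ E, ∀ z, Tendsto (fun i => φ i z) U (𝓝 (ψ z)) := by
  have hK := WeakDual.isCompact_closedBall (𝕜 := ℝ) (E := E) 0 R
  obtain ⟨ψ, -, hψ⟩ := hK.ultrafilter_le_nhds (U.map fun i => StrongDual.toWeakDual (φ i)) (by
    rw [le_principal_iff]
    refine Filter.mem_map.2 (univ_mem' fun i => ?_)
    simpa [Metric.mem_closedBall] using h i)
  refine ⟨WeakDual.toStrongDual ψ, fun z => ?_⟩
  exact ((WeakDual.eval_continuous z).tendsto ψ).comp hψ

variable {X : Type*} [NormedAddCommGroup X] [NormedSpace ℝ X] {p : Seminorm ℝ X}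

/-- The unit ball of a reflexive space is weakly compact. -/
theorem IsReflexiveSpace.exists_weak_limit (hX : IsReflexiveSpace X) (hp : IsEquivalentNorm p)
    {u : ℕ → X} (hu : ∀ n, p (u n) ≤ 1) (U : Ultrafilter ℕ) :
    ∃ w, p w ≤ 1 ∧ ∀ g : StrongDual ℝ X, Tendsto (fun n => g (u n)) U (𝓝 (g w)) := by
  obtain ⟨c, C, hc, -, h⟩ := id hp
  obtain ⟨Ψ, hΨ⟩ := exists_tendsto_apply_of_norm_le U
    (fun n => NormedSpace.inclusionInDoubleDual ℝ X (u n)) (R := c⁻¹) (fun n => by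
      refine (NormedSpace.double_dual_bound ℝ X _).trans ?_
      rw [← one_div, le_div_iff₀' hc]
      exact (h _).1.trans (hu n))
  obtain ⟨w, rfl⟩ := hX Ψ
  refine ⟨w, ?_, hΨ⟩
  -- The closed convex unit ball is weakly closed.
  by_contra hw
  obtain ⟨g, s, hg, hs⟩ := geometric_hahn_banach_closed_point (s := {x | p x ≤ 1}) (x := w)
    (by simpa [Seminorm.closedBall_zero_eq] using p.convex_closedBall 0 1)
    (isClosed_le hp.continuous continuous_const) hw
  exact hs.not_ge (le_of_tendsto (hΨ g) (.of_forall fun n => (hg _ (hu n)).le))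

theorem IsReflexiveSpace.isALUR (hX : IsReflexiveSpace X) (hp : IsEquivalentNorm p) {x : X}
    (hx : IsNSE p x) : IsALUR p x := by
  refine ⟨hx.1, fun u f hu hf ⟨α, hα, hα1⟩ => ?_⟩
  have hfle : ∀ m z, |f m z| ≤ p z := fun m => hp.abs_le_of_dualNorm_le_one (hf m).le
  have hu' : ∀ n, p (u n) ≤ 1 := fun n => (hu n).le
  have hx' : p x = 1 := hx.1
  -- The inner limits split, and both summands are at most `1`.
  have hβ : ∀ m, Tendsto (fun n => f m (u n)) atTop (𝓝 (2 * α m - f m x)) := fun m => by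
    refine (((hα m).const_mul 2).sub_const (f m x)).congr fun n => ?_
    simp
    ring
  have hfx1 : ∀ m, f m x ≤ 1 := fun m => (le_abs_self _).trans ((hfle m x).trans hx'.le)
  have hβ1 : ∀ m, 2 * α m - f m x ≤ 1 := fun m =>
    le_of_tendsto (hβ m) (.of_forall fun n => (le_abs_self _).trans ((hfle m _).trans (hu' n)))
  have hfx : Tendsto (fun m => f m x) atTop (𝓝 1) := by
    refine tendsto_of_tendsto_of_tendsto_of_le_of_le (g := fun m => 2 * α m - 1) ?_
      tendsto_const_nhds (fun m => by linarith [hβ1 m]) hfx1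
    have := (hα1.const_mul 2).sub_const 1
    norm_num at this
    exact this
  have hβlim : Tendsto (fun m => 2 * α m - f m x) atTop (𝓝 1) := by
    have := (hα1.const_mul 2).sub hfx
    norm_num at this
    exact this
  obtain ⟨c, C, hc, hC, h⟩ := id hp
  let V : Ultrafilter ℕ := hyperfilter ℕ
  have hV : (V : Filter ℕ) ≤ atTop := Nat.hyperfilter_le_atTop
  obtain ⟨φ, hφ⟩ := exists_tendsto_apply_of_norm_le V f (R := C) (fun m =>
    (f m).opNorm_le_bound hC.le fun z => (hfle m z).trans (h z).2)
  have hφx : φ x = 1 := tendsto_nhds_unique (hφ x) (hfx.mono_left hV)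
  have hφle : ∀ z, |φ z| ≤ p z := fun z => le_of_tendsto (hφ z).abs (.of_forall fun m => hfle m z)
  have hφD : φ ∈ dualityMap p x := by
    refine ⟨le_antisymm (dualNorm_le fun z hz => (hφle z).trans hz) ?_, hφx⟩
    simpa [hφx] using hp.abs_le_dualNorm φ hx'.le
  refine hx.2 φ hφD u hu' ?_
  rw [← hφx]
  -- Every weak cluster point of `u` is supported by `φ`, hence equal to `x`.
  refine tendsto_iff_ultrafilter _ _ _ |>.2 fun U hU => ?_
  obtain ⟨w, hw1, hw⟩ := hX.exists_weak_limit hp hu' U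
  have hfw : ∀ m, f m w = 2 * α m - f m x := fun m =>
    tendsto_nhds_unique (hw (f m)) ((hβ m).mono_left hU)
  have hφw : φ w = 1 :=
    tendsto_nhds_unique (hφ w) ((hβlim.mono_left hV).congr fun m => (hfw m).symm)
  have hwx : p (w - x) = 0 := tendsto_nhds_unique tendsto_const_nhds
    (hx.2 φ hφD (fun _ => w) (fun _ => hw1) (by simp [hφw]))
  rw [← sub_eq_zero.1 (hp.eq_zero hwx)]
  exact hw φ

end Reflexive

/-! ### Interpolation and triangular systems in nonreflexive spaces -/

section Interpolation

variable {X : Type*} [NormedAddCommGroup X] [NormedSpace ℝ X]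

/-- Finitely many functionals cannot tell an element of the bidual from the elements of a
slightly larger ball of `X`. -/
theorem exists_norm_lt_forall_apply_eq (Ξ : StrongDual ℝ (StrongDual ℝ X)) {R : ℝ} (hR : ‖Ξ‖ < R)
    (t : Finset (StrongDual ℝ X)) : ∃ y, ‖y‖ < R ∧ ∀ g ∈ t, g y = Ξ g := by
  classical
  -- Solvability without a norm bound.
  obtain ⟨y₀, hy₀⟩ : ∃ y₀ : X, ∀ g ∈ t, g y₀ = Ξ g := by
    let G : X →ₗ[ℝ] (t → ℝ) := LinearMap.pi fun g => (g : StrongDual ℝ X).toLinearMap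
    by_cases hmem : (fun g : t => Ξ g) ∈ LinearMap.range G
    · obtain ⟨y, hy⟩ := hmem
      exact ⟨y, fun g hg => congrFun hy ⟨g, hg⟩⟩
    obtain ⟨l, hl, hker⟩ := Submodule.exists_le_ker_of_notMem hmem
    exfalso
    apply hl
    have hexp : ∀ v : t → ℝ, l v = ∑ g : t, v g * l (Pi.single g 1) := fun v => by
      conv_lhs => rw [← Finset.univ_sum_single v, map_sum]
      refine Finset.sum_congr rfl fun g _ => ?_
      rw [← smul_eq_mul, ← map_smul, ← Pi.single_smul', smul_eq_mul, mul_one]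
    have hzero : ∑ g : t, l (Pi.single g 1) • (g : StrongDual ℝ X) = 0 := by
      ext x
      have h1 : l (G x) = 0 := hker ⟨x, rfl⟩
      rw [hexp] at h1
      simpa [sum_apply, mul_comm, G] using h1
    rw [hexp]
    have h2 := congrArg Ξ hzero
    simpa [mul_comm] using h2
  let N : Submodule ℝ X := ⨅ g : t, LinearMap.ker (g : StrongDual ℝ X).toLinearMap
  have hmemN : ∀ {z}, z ∈ N ↔ ∀ g ∈ t, g z = 0 := by
    intro z
    simp [N, Submodule.mem_iInf]
  -- The quotient norm of `y₀` modulo the common kernel is computed by a functional in the span.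
  obtain ⟨k, hk, hlt⟩ : ∃ k, k ∈ N ∧ ‖y₀ + k‖ < R := by
    obtain ⟨h, hh1, hh⟩ := exists_dual_vector'' ℝ (N.mkQ y₀)
    let η : StrongDual ℝ X := h.comp N.mkQL
    have hη : ‖η‖ ≤ 1 := by
      refine η.opNorm_le_bound zero_le_one fun x => ?_
      calc ‖h (N.mkQ x)‖ ≤ 1 * ‖N.mkQ x‖ := h.le_of_opNorm_le hh1 _
        _ ≤ 1 * ‖x‖ := by gcongr; exact Submodule.Quotient.norm_mk_le N x
    have hspan : η.toLinearMap ∈ Submodule.span ℝ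
        (Set.range fun g : t => (g : StrongDual ℝ X).toLinearMap) := by
      refine mem_span_of_iInf_ker_le_ker fun z hz => ?_
      have : N.mkQ z = 0 := by simpa [hmemN] using hz
      change h (N.mkQ z) = 0
      rw [this, map_zero]
    obtain ⟨a, ha⟩ := (Submodule.mem_span_range_iff_exists_fun ℝ).1 hspan
    have hηsum : η = ∑ g : t, a g • (g : StrongDual ℝ X) := by
      ext x
      have := LinearMap.congr_fun ha x
      simpa [sum_apply] using this.symm
    have hηΞ : η y₀ = Ξ η := by
      rw [hηsum]
      simp only [sum_apply, map_sum, map_smul, smul_eq_mul,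
        smul_apply]
      exact Finset.sum_congr rfl fun g _ => by rw [hy₀ g g.2]
    have hq : ‖N.mkQ y₀‖ < R := by
      have h1 : η y₀ = ‖N.mkQ y₀‖ := hh
      rw [← h1, hηΞ]
      calc Ξ η ≤ ‖Ξ‖ * ‖η‖ := (le_abs_self _).trans (Ξ.le_opNorm η)
        _ ≤ ‖Ξ‖ := mul_le_of_le_one_right (norm_nonneg Ξ) hη
        _ < R := hR
    obtain ⟨z, hz, hzR⟩ := Submodule.Quotient.norm_mk_lt (N.mkQ y₀) (sub_pos.2 hq)
    exact ⟨z - y₀, (Submodule.Quotient.eq N).1 hz, by simpa using hzR⟩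
  exact ⟨y₀ + k, hlt, fun g hg => by simp [hmemN.1 hk g hg, hy₀ g hg]⟩

/-- If `Ξ` is at distance at least `δ` from `X`, then its restriction to the annihilator of a finite
set still has norm at least `δ`, as the annihilator of that annihilator is the span of the set. -/
theorem exists_apply_eq_one_forall_apply_eq_zero {Ξ : StrongDual ℝ (StrongDual ℝ X)} {δ : ℝ}
    (hδ : 0 < δ) (hΞ : ∀ x, δ ≤ ‖Ξ - NormedSpace.inclusionInDoubleDual ℝ X x‖) (s : Finset X) :
    ∃ g : StrongDual ℝ X, ‖g‖ ≤ 2 / δ ∧ Ξ g = 1 ∧ ∀ x ∈ s, g x = 0 := by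
  let J := NormedSpace.inclusionInDoubleDual ℝ X
  let W : Submodule ℝ (StrongDual ℝ X) := ⨅ x : s, LinearMap.ker (J x).toLinearMap
  have hW : ∀ {g}, g ∈ W ↔ ∀ x ∈ s, g x = 0 := by
    intro g
    simp [W, J, Submodule.mem_iInf]
  obtain ⟨g, hgW, hg⟩ : ∃ g ∈ W, δ / 2 * ‖g‖ < |Ξ g| := by
    by_contra! hcon
    -- Otherwise `Ξ` agrees on `W` with a functional of norm at most `δ / 2`, and the difference
    -- comes from `X`.
    obtain ⟨Ψ, hΨ, hnorm⟩ := exists_extension_norm_eq W (Ξ.comp W.subtypeL)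
    have hΨle : ‖Ψ‖ ≤ δ / 2 := by
      rw [hnorm]
      exact ContinuousLinearMap.opNorm_le_bound _ (by positivity) fun g => hcon g g.2
    have hspan : (Ξ - Ψ).toLinearMap ∈
        Submodule.span ℝ (Set.range fun x : s => (J x).toLinearMap) := by
      refine mem_span_of_iInf_ker_le_ker fun g hg => ?_
      have := hΨ ⟨g, hg⟩
      simp only [LinearMap.mem_ker]
      change Ξ g - Ψ g = 0
      rw [this]
      simp
    obtain ⟨a, ha⟩ := (Submodule.mem_span_range_iff_exists_fun ℝ).1 hspan
    have hJ : J (∑ x : s, a x • (x : X)) = Ξ - Ψ := by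
      ext g
      have := LinearMap.congr_fun ha g
      simpa [J] using this
    have h1 := hΞ (∑ x : s, a x • (x : X))
    have h2 : Ξ - J (∑ x : s, a x • (x : X)) = Ψ := by
      rw [hJ]
      ext g
      simp
    rw [h2] at h1
    linarith
  have hpos : 0 < |Ξ g| := lt_of_le_of_lt (by positivity) hg
  refine ⟨(Ξ g)⁻¹ • g, ?_, ?_, fun x hx => ?_⟩
  · rw [norm_smul, norm_inv, Real.norm_eq_abs, inv_mul_le_iff₀ hpos]
    calc ‖g‖ = (δ / 2 * ‖g‖) * (2 / δ) := by field_simp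
      _ ≤ |Ξ g| * (2 / δ) := by gcongr
  · simp [abs_pos.1 hpos]
  · simp [hW.1 hgW x hx]

theorem exists_pos_forall_le_norm_sub {E : Type*} [SeminormedAddCommGroup E] {s : Set E}
    (hs : IsClosed s) {x : E} (hx : x ∉ s) : ∃ δ > 0, ∀ y ∈ s, δ ≤ ‖x - y‖ := by
  obtain ⟨δ, hδ, hball⟩ := Metric.isOpen_iff.1 hs.isOpen_compl x hx
  refine ⟨δ, hδ, fun y hy => ?_⟩
  by_contra! hlt
  exact hball (mem_ball_iff_norm'.2 hlt) hy

/-- James' criterion: in a nonreflexive Banach space there are bounded sequences of vectors and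
functionals with triangular matrix of values, and the functionals can be chosen to vanish at a
prescribed vector. -/
theorem exists_triangular_of_not_isReflexiveSpace [CompleteSpace X] (hX : ¬ IsReflexiveSpace X)
    (e : X) : ∃ (g : ℕ → StrongDual ℝ X) (y : ℕ → X) (K R : ℝ),
      (∀ m, ‖g m‖ ≤ K) ∧ (∀ n, ‖y n‖ ≤ R) ∧ (∀ m, g m e = 0) ∧
      (∀ m n, m ≤ n → g m (y n) = 1) ∧ ∀ m n, n < m → g m (y n) = 0 := by
  classical
  obtain ⟨Ξ, hΞ⟩ : ∃ Ξ, ∀ x, NormedSpace.inclusionInDoubleDual ℝ X x ≠ Ξ := by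
    simpa [IsReflexiveSpace, Function.Surjective] using hX
  obtain ⟨δ, hδ, hdist⟩ :
      ∃ δ > 0, ∀ x, δ ≤ ‖Ξ - NormedSpace.inclusionInDoubleDual ℝ X x‖ := by
    have hclosed : IsClosed (Set.range (NormedSpace.inclusionInDoubleDual ℝ X)) :=
      (NormedSpace.inclusionInDoubleDualLi ℝ (E := X)).isometry.isUniformInducing
        |>.isComplete_range.isClosed
    obtain ⟨δ, hδ, h⟩ := exists_pos_forall_le_norm_sub hclosed (x := Ξ)
      (by rintro ⟨x, hx⟩; exact hΞ x hx)
    exact ⟨δ, hδ, fun x => h _ ⟨x, rfl⟩⟩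
  obtain ⟨s, hs, hlt⟩ := exists_seq_of_forall_finset_exists
    (fun a : StrongDual ℝ X × X =>
      ‖a.1‖ ≤ 2 / δ ∧ ‖a.2‖ ≤ ‖Ξ‖ + 1 ∧ Ξ a.1 = 1 ∧ a.1 e = 0 ∧ a.1 a.2 = 1)
    (fun a b => a.1 b.2 = 1 ∧ b.1 a.2 = 0) (fun s hs => by
      obtain ⟨g, hg, hg1, hg0⟩ := exists_apply_eq_one_forall_apply_eq_zero hδ hdist
        (insert e (s.image Prod.snd))
      obtain ⟨y, hy, hy1⟩ := exists_norm_lt_forall_apply_eq Ξ (lt_add_one ‖Ξ‖)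
        (insert g (s.image Prod.fst))
      refine ⟨(g, y), ⟨hg, hy.le, hg1, hg0 e (by simp), ?_⟩, fun a ha => ⟨?_, ?_⟩⟩
      · rw [hy1 g (by simp), hg1]
      · rw [hy1 a.1 (Finset.mem_insert_of_mem (Finset.mem_image_of_mem _ ha)), (hs a ha).2.2.1]
      · exact hg0 a.2 (Finset.mem_insert_of_mem (Finset.mem_image_of_mem _ ha)))
  refine ⟨fun m => (s m).1, fun n => (s n).2, 2 / δ, ‖Ξ‖ + 1, fun m => (hs m).1,
    fun n => (hs n).2.1, fun m => (hs m).2.2.2.1, fun m n hmn => ?_, fun m n hnm => (hlt n m hnm).2⟩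
  rcases hmn.eq_or_lt with rfl | h
  · exact (hs m).2.2.2.2
  · exact (hlt m n h).1

end Interpolation

/-! ### A renorming for which a given vector is nicely strongly exposed -/

section Renorm

variable {X : Type*} [NormedAddCommGroup X] [NormedSpace ℝ X]

/-- The seminorm `x ↦ √(q x ^ 2 + r x ^ 2)`. -/
noncomputable def hypotSeminorm (q r : Seminorm ℝ X) : Seminorm ℝ X :=
  Seminorm.of (fun x => √(q x ^ 2 + r x ^ 2))
    (fun x y => by
      have hq := map_add_le_add q x y
      have hr := map_add_le_add r x y
      have hq0 := apply_nonneg q (x + y)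
      have hr0 := apply_nonneg r (x + y)
      have hA : 0 ≤ q x ^ 2 + r x ^ 2 := by positivity
      have hB : 0 ≤ q y ^ 2 + r y ^ 2 := by positivity
      -- The Cauchy–Schwarz inequality in the plane.
      have hCS : q x * q y + r x * r y ≤ √(q x ^ 2 + r x ^ 2) * √(q y ^ 2 + r y ^ 2) := by
        rw [← Real.sqrt_mul hA]
        exact Real.le_sqrt_of_sq_le (by nlinarith [sq_nonneg (q x * r y - q y * r x)])
      refine Real.sqrt_le_iff.2 ⟨by positivity, ?_⟩
      have h1 : q (x + y) ^ 2 ≤ (q x + q y) ^ 2 := by gcongr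
      have h2 : r (x + y) ^ 2 ≤ (r x + r y) ^ 2 := by gcongr
      nlinarith [Real.sq_sqrt hA, Real.sq_sqrt hB])
    (fun a x => by
      rw [map_smul_eq_mul, map_smul_eq_mul, mul_pow, mul_pow, ← mul_add,
        Real.sqrt_mul (by positivity), Real.sqrt_sq (norm_nonneg a)])

/-- The seminorm `x ↦ sup_i |f i x|`, meaningful for pointwise bounded families `f`. -/
noncomputable def supSeminorm {ι : Type*} (f : ι → StrongDual ℝ X) : Seminorm ℝ X :=
  ⨆ i, (normSeminorm ℝ ℝ).comp (f i).toLinearMap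

theorem supSeminorm_apply {ι : Type*} {f : ι → StrongDual ℝ X} {q : Seminorm ℝ X}
    (h : ∀ i x, |f i x| ≤ q x) (x : X) : supSeminorm f x = ⨆ i, |f i x| := by
  rw [supSeminorm, Seminorm.iSup_apply]
  · rfl
  · refine ⟨q, ?_⟩
    rintro _ ⟨i, rfl⟩
    exact fun x => h i x

theorem abs_le_supSeminorm {ι : Type*} {f : ι → StrongDual ℝ X} {q : Seminorm ℝ X}
    (h : ∀ i x, |f i x| ≤ q x) (i : ι) (x : X) : |f i x| ≤ supSeminorm f x := by
  rw [supSeminorm_apply h]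
  refine le_ciSup (f := fun i => |f i x|) ⟨q x, ?_⟩ i
  rintro _ ⟨j, rfl⟩
  exact h j x

theorem supSeminorm_le {ι : Type*} {f : ι → StrongDual ℝ X} {q : Seminorm ℝ X}
    (h : ∀ i x, |f i x| ≤ q x) {x : X} {K : ℝ} (hK : 0 ≤ K) (hx : ∀ i, |f i x| ≤ K) :
    supSeminorm f x ≤ K := by
  rw [supSeminorm_apply h]
  exact Real.iSup_le hx hK

/-- The functionals dominated by `ν` with value one at `e`: the subdifferential of `ν` at `e`
when `ν e = 1`. -/
def supportSet (ν : Seminorm ℝ X) (e : X) : Set (StrongDual ℝ X) :=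
  {h | h e = 1 ∧ ∀ x, |h x| ≤ ν x}

/-- The supremum of the functionals that support `ν` at `e`. -/
noncomputable def supportSeminorm (ν : Seminorm ℝ X) (e : X) : Seminorm ℝ X :=
  supSeminorm fun h : supportSet ν e => (h : StrongDual ℝ X)

theorem abs_le_supportSeminorm {ν : Seminorm ℝ X} {e : X} {h : StrongDual ℝ X}
    (hh : h ∈ supportSet ν e) (x : X) : |h x| ≤ supportSeminorm ν e x :=
  abs_le_supSeminorm (f := fun h : supportSet ν e => (h : StrongDual ℝ X)) (q := ν)
    (fun h => h.2.2) ⟨h, hh⟩ x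

theorem supportSeminorm_le_of_forall {ν : Seminorm ℝ X} {e x : X} {K : ℝ} (hK : 0 ≤ K)
    (h : ∀ f ∈ supportSet ν e, |f x| ≤ K) : supportSeminorm ν e x ≤ K :=
  supSeminorm_le (q := ν) (fun h => h.2.2) hK fun f => h f f.2

theorem supportSeminorm_le {ν : Seminorm ℝ X} {e : X} (x : X) : supportSeminorm ν e x ≤ ν x :=
  supportSeminorm_le_of_forall (apply_nonneg ν x) fun _ h => h.2 x

/-- The maximum of `ν` and of `√(τ ^ 2 + ρ ^ 2)`, where `τ` is the supremum of the functionals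
that support `ν` at `e`. If `ρ` vanishes at `e`, then this norm has the same supporting
functionals at `e` as `ν`, and `ρ` makes each of them strongly expose `e`. -/
noncomputable def exposingNorm (ν ρ : Seminorm ℝ X) (e : X) : Seminorm ℝ X :=
  ν ⊔ hypotSeminorm (supportSeminorm ν e) ρ

variable {ν ρ : Seminorm ℝ X} {e : X}

theorem exposingNorm_apply (x : X) :
    exposingNorm ν ρ e x = max (ν x) (√(supportSeminorm ν e x ^ 2 + ρ x ^ 2)) := rfl

theorem le_exposingNorm (x : X) : ν x ≤ exposingNorm ν ρ e x := le_max_left _ _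

theorem sq_add_sq_le_exposingNorm_sq (x : X) :
    supportSeminorm ν e x ^ 2 + ρ x ^ 2 ≤ exposingNorm ν ρ e x ^ 2 :=
  (Real.sqrt_le_left (apply_nonneg _ x)).1 (le_max_right _ _)

theorem exposingNorm_le_iff {x : X} {K : ℝ} (hK : 0 ≤ K) :
    exposingNorm ν ρ e x ≤ K ↔ ν x ≤ K ∧ supportSeminorm ν e x ^ 2 + ρ x ^ 2 ≤ K ^ 2 := by
  rw [exposingNorm_apply, max_le_iff, Real.sqrt_le_left hK]

theorem exposingNorm_sq_le (x : X) : exposingNorm ν ρ e x ^ 2 ≤ ν x ^ 2 + ρ x ^ 2 := by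
  have h : exposingNorm ν ρ e x ≤ √(ν x ^ 2 + ρ x ^ 2) := by
    rw [exposingNorm_le_iff (Real.sqrt_nonneg _), Real.sq_sqrt (by positivity)]
    refine ⟨Real.le_sqrt_of_sq_le (by nlinarith [sq_nonneg (ρ x)]), ?_⟩
    gcongr
    exact supportSeminorm_le x
  calc exposingNorm ν ρ e x ^ 2 ≤ √(ν x ^ 2 + ρ x ^ 2) ^ 2 :=
        pow_le_pow_left₀ (apply_nonneg _ x) h 2
    _ = _ := Real.sq_sqrt (by positivity)

theorem exposingNorm_self (hν : ν e = 1) (hρ : ρ e = 0) : exposingNorm ν ρ e e = 1 := by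
  refine le_antisymm ?_ (hν ▸ le_exposingNorm e)
  rw [exposingNorm_le_iff zero_le_one, hν, hρ]
  have := supportSeminorm_le (ν := ν) (e := e) e
  rw [hν] at this
  have h0 := apply_nonneg (supportSeminorm ν e) e
  exact ⟨le_rfl, by nlinarith⟩

theorem exposingNorm_isEquivalentNorm {E : StrongDual ℝ X} {C D M : ℝ} (hC : 0 < C) (hD : 0 < D)
    (hM : 0 < M) (hνe : ν e = 1) (hν : ∀ x, ν x ≤ C * ‖x‖) (hρ : ∀ x, ρ x ≤ D * ‖x‖)
    (hE : ∀ x, ‖x - E x • e‖ ≤ M * ρ x) : IsEquivalentNorm (exposingNorm ν ρ e) := by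
  have hρle : ∀ x, ρ x ≤ exposingNorm ν ρ e x := fun x => by
    have h1 := sq_add_sq_le_exposingNorm_sq (ν := ν) (ρ := ρ) (e := e) x
    have h2 : ρ x ^ 2 ≤ exposingNorm ν ρ e x ^ 2 := by
      linarith [sq_nonneg (supportSeminorm ν e x)]
    exact (pow_le_pow_iff_left₀ (apply_nonneg ρ x) (apply_nonneg _ x) two_ne_zero).1 h2
  have hA : 0 < (1 + C * M) * ‖e‖ + M := by positivity
  refine ⟨((1 + C * M) * ‖e‖ + M)⁻¹, C + D, by positivity, by positivity, fun x => ⟨?_, ?_⟩⟩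
  · rw [inv_mul_le_iff₀ hA]
    have hp := apply_nonneg (exposingNorm ν ρ e) x
    have hw : ‖x - E x • e‖ ≤ M * exposingNorm ν ρ e x :=
      (hE x).trans (by gcongr; exact hρle x)
    have ht : |E x| ≤ (1 + C * M) * exposingNorm ν ρ e x := by
      have h1 : ν (E x • e) = |E x| := by rw [map_smul_eq_mul, hνe, mul_one, Real.norm_eq_abs]
      have h2 : ν (E x • e) ≤ ν x + ν (x - E x • e) := by
        simpa using map_sub_le_add ν x (x - E x • e)
      have h3 := hν (x - E x • e)
      have h4 : C * ‖x - E x • e‖ ≤ C * (M * exposingNorm ν ρ e x) := by gcongr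
      have h5 := le_exposingNorm (ν := ν) (ρ := ρ) (e := e) x
      linarith
    calc ‖x‖ = ‖E x • e + (x - E x • e)‖ := by rw [add_sub_cancel]
      _ ≤ ‖E x • e‖ + ‖x - E x • e‖ := norm_add_le _ _
      _ = |E x| * ‖e‖ + ‖x - E x • e‖ := by rw [norm_smul, Real.norm_eq_abs]
      _ ≤ (1 + C * M) * exposingNorm ν ρ e x * ‖e‖ + M * exposingNorm ν ρ e x := by gcongr
      _ = _ := by ring
  · have h1 := exposingNorm_sq_le (ν := ν) (ρ := ρ) (e := e) x
    have hν0 := apply_nonneg ν x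
    have hρ0 := apply_nonneg ρ x
    have h2 : exposingNorm ν ρ e x ≤ ν x + ρ x :=
      abs_le_of_sq_le_sq' (by nlinarith) (by positivity) |>.2
    linarith [hν x, hρ x]

/-- A functional that supports the larger norm at `e` is dominated by `ν`: on the line `e + s y`
the two norms differ by `O(s ^ 2)` only. -/
theorem mem_supportSet_of_le_exposingNorm (hνe : ν e = 1) (hρe : ρ e = 0) {h : StrongDual ℝ X}
    (he : h e = 1) (hh : ∀ x, |h x| ≤ exposingNorm ν ρ e x) : h ∈ supportSet ν e := by
  have key : ∀ y, h y ≤ ν y := fun y => by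
    by_contra! hlt
    have hν0 := apply_nonneg ν y
    set s : ℝ := (h y - ν y) / (ρ y ^ 2 + 1) with hs
    have hs0 : 0 < s := div_pos (sub_pos.2 hlt) (by positivity)
    have hsρ : s * (ρ y ^ 2 + 1) = h y - ν y := by rw [hs]; field_simp
    have h1 : (1 + s * h y) ^ 2 ≤ exposingNorm ν ρ e (e + s • y) ^ 2 := by
      have := hh (e + s • y)
      rw [map_add, map_smul, he, smul_eq_mul] at this
      exact sq_le_sq' (by linarith [neg_abs_le (1 + s * h y)]) ((le_abs_self _).trans this)
    have h2 := exposingNorm_sq_le (ν := ν) (ρ := ρ) (e := e) (e + s • y)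
    have h3 : ν (e + s • y) ≤ 1 + s * ν y := by
      have := map_add_le_add ν e (s • y)
      rwa [hνe, map_smul_eq_mul, Real.norm_of_nonneg hs0.le] at this
    have h4 : ρ (e + s • y) ≤ s * ρ y := by
      have := map_add_le_add ρ e (s • y)
      rwa [hρe, map_smul_eq_mul, Real.norm_of_nonneg hs0.le, zero_add] at this
    have h5 : ν (e + s • y) ^ 2 ≤ (1 + s * ν y) ^ 2 :=
      pow_le_pow_left₀ (apply_nonneg _ _) h3 2
    have h6 : ρ (e + s • y) ^ 2 ≤ (s * ρ y) ^ 2 := pow_le_pow_left₀ (apply_nonneg _ _) h4 2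
    have h7 : s * (2 * (h y - ν y)) + s * (s * (h y ^ 2 - ν y ^ 2)) ≤ s * (s * ρ y ^ 2) := by
      nlinarith
    rw [← mul_add] at h7
    have h8 := le_of_mul_le_mul_left h7 hs0
    have h9 : 0 ≤ s * (h y ^ 2 - ν y ^ 2) := mul_nonneg hs0.le (by nlinarith)
    nlinarith
  refine ⟨he, fun x => abs_le.2 ⟨?_, key x⟩⟩
  have := key (-x)
  rw [map_neg, map_neg_eq_map] at this
  linarith

theorem isNSE_exposingNorm (hp : IsEquivalentNorm (exposingNorm ν ρ e)) (hνe : ν e = 1)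
    (hρe : ρ e = 0) {E : StrongDual ℝ X} {M : ℝ} (hE : ∀ x, ‖x - E x • e‖ ≤ M * ρ x) :
    IsNSE (exposingNorm ν ρ e) e := by
  set p := exposingNorm ν ρ e with hpdef
  have hpe : p e = 1 := exposingNorm_self hνe hρe
  refine ⟨hpe, fun h hh u hu hlim => ?_⟩
  have hmem : h ∈ supportSet ν e :=
    mem_supportSet_of_le_exposingNorm hνe hρe hh.2 (hp.abs_le_of_dualNorm_le_one hh.1.le)
  -- The component of `u n` transversal to `e` tends to zero.
  have hρsq : Tendsto (fun n => ρ (u n) ^ 2) atTop (𝓝 0) := by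
    refine tendsto_of_tendsto_of_tendsto_of_le_of_le tendsto_const_nhds
      (h := fun n => 1 - h (u n) ^ 2) ?_ (fun n => by positivity) fun n => ?_
    · simpa using (hlim.pow 2).const_sub 1
    · have h1 := sq_add_sq_le_exposingNorm_sq (ν := ν) (ρ := ρ) (e := e) (u n)
      have h2 : exposingNorm ν ρ e (u n) ^ 2 ≤ 1 := pow_le_one₀ (apply_nonneg _ _) (hu n)
      have h3 : h (u n) ^ 2 ≤ supportSeminorm ν e (u n) ^ 2 := by
        rw [← sq_abs]
        exact pow_le_pow_left₀ (abs_nonneg _) (abs_le_supportSeminorm hmem _) 2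
      linarith
  have hρ : Tendsto (fun n => ρ (u n)) atTop (𝓝 0) := by
    have := hρsq.sqrt
    simpa [Real.sqrt_sq (apply_nonneg ρ _)] using this
  obtain ⟨c, C, -, hC, hcC⟩ := hp
  have hbound : ∀ n, p (u n - e) ≤
      C * ((1 + ‖h‖ * ‖e‖) * (M * ρ (u n))) + |h (u n) - 1| := fun n => by
    set w := u n - E (u n) • e with hw
    have hdecomp : u n - e = (w - h w • e) + (h (u n) - 1) • e := by
      rw [hw, map_sub, map_smul, hh.2, smul_eq_mul, mul_one]
      module
    have hwn : ‖w - h w • e‖ ≤ (1 + ‖h‖ * ‖e‖) * (M * ρ (u n)) := by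
      calc ‖w - h w • e‖ ≤ ‖w‖ + ‖h w • e‖ := norm_sub_le _ _
        _ ≤ ‖w‖ + ‖h‖ * ‖w‖ * ‖e‖ := by rw [norm_smul]; gcongr; exact h.le_opNorm w
        _ = (1 + ‖h‖ * ‖e‖) * ‖w‖ := by ring
        _ ≤ _ := by gcongr; exact hE (u n)
    rw [hdecomp]
    calc p (w - h w • e + (h (u n) - 1) • e) ≤ p (w - h w • e) + p ((h (u n) - 1) • e) :=
          map_add_le_add p _ _
      _ ≤ C * ‖w - h w • e‖ + |h (u n) - 1| := by
          rw [map_smul_eq_mul, hpe, mul_one, Real.norm_eq_abs]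
          gcongr
          exact (hcC _).2
      _ ≤ _ := by gcongr
  refine tendsto_of_tendsto_of_tendsto_of_le_of_le tendsto_const_nhds ?_
    (fun n => apply_nonneg p _) hbound
  have := (((hρ.const_mul M).const_mul (1 + ‖h‖ * ‖e‖)).const_mul C).add (hlim.sub_const 1).abs
  simpa using this

end Renorm

/-! ### The nonreflexive case -/

section Nonreflexive

variable {X : Type*} [NormedAddCommGroup X] [NormedSpace ℝ X]

/-- Sequences in the unit ball and the dual unit ball can replace sequences in the unit spheres:
the normalizing factors tend to one. -/
theorem IsALUR.tendsto_of_tendsto_iterated {p : Seminorm ℝ X} (hp : IsEquivalentNorm p) {x : X}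
    (hx : IsALUR p x) {u : ℕ → X} {f : ℕ → StrongDual ℝ X} {β : ℕ → ℝ}
    (hu : ∀ n, p (u n) ≤ 1) (hu0 : ∀ n, p (u n) ≠ 0) (hf : ∀ m, dualNorm p (f m) ≤ 1)
    (hfx0 : ∀ m, 0 < f m x) (hfx : Tendsto (fun m => f m x) atTop (𝓝 1))
    (hβ : ∀ m, Tendsto (fun n => f m (u n)) atTop (𝓝 (β m))) (hβ1 : Tendsto β atTop (𝓝 1)) :
    ConvergesTo p (fun n => (p (u n))⁻¹ • u n) x ∧ Tendsto (fun n => p (u n)) atTop (𝓝 1) := by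
  have hle : ∀ m z, |f m z| ≤ p z := fun m => hp.abs_le_of_dualNorm_le_one (hf m)
  have hpu : Tendsto (fun n => p (u n)) atTop (𝓝 1) := by
    refine tendsto_order.2 ⟨fun a ha => ?_, fun a ha => .of_forall fun n => (hu n).trans_lt ha⟩
    obtain ⟨m, hm⟩ := (hβ1.eventually_const_lt ha).exists
    filter_upwards [(hβ m).eventually_const_lt hm] with n hn
    exact hn.trans_le ((le_abs_self _).trans (hle m _))
  refine ⟨?_, hpu⟩
  have hd : ∀ m, f m x ≤ dualNorm p (f m) := fun m =>
    (le_abs_self _).trans (hp.abs_le_dualNorm (f m) (le_of_eq hx.1))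
  have hdpos : ∀ m, 0 < dualNorm p (f m) := fun m => (hfx0 m).trans_le (hd m)
  have hdlim : Tendsto (fun m => dualNorm p (f m)) atTop (𝓝 1) :=
    tendsto_of_tendsto_of_tendsto_of_le_of_le hfx tendsto_const_nhds hd hf
  refine hx.2 _ (fun m => (dualNorm p (f m))⁻¹ • f m) (fun n => ?_) (fun m => ?_)
    ⟨fun m => (dualNorm p (f m))⁻¹ * (1 / 2 * (1⁻¹ * β m + f m x)), fun m => ?_, ?_⟩
  · change p _ = 1
    rw [map_smul_eq_mul, norm_inv, Real.norm_of_nonneg (apply_nonneg p _), inv_mul_cancel₀ (hu0 n)]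
  · change dualNorm p _ = 1
    rw [dualNorm_smul_of_nonneg (inv_nonneg.2 (hdpos m).le), inv_mul_cancel₀ (hdpos m).ne']
  · refine ((((hpu.inv₀ one_ne_zero).mul (hβ m)).add_const _).const_mul _ |>.const_mul _).congr
      fun n => ?_
    simp only [smul_apply, map_smul, map_add, smul_eq_mul]
    ring
  · have := (hdlim.inv₀ one_ne_zero).mul (((hβ1.const_mul 1⁻¹).add hfx).const_mul (1 / 2))
    norm_num at this
    simpa using this

/-- Perturbing a functional `E` with `E e = 1` by a triangular system vanishing at `e` produces a
norm for which `e` is nicely strongly exposed but not almost locally uniformly rotund. -/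
theorem exists_isNSE_not_isALUR [CompleteSpace X] (hX : ¬ IsReflexiveSpace X) :
    ∃ (p : Seminorm ℝ X) (e : X), IsEquivalentNorm p ∧ IsNSE p e ∧ ¬ IsALUR p e := by
  have hnt : Nontrivial X := by
    by_contra hsub
    rw [not_nontrivial_iff_subsingleton] at hsub
    refine hX fun Ψ => ⟨0, ?_⟩
    ext g
    simp [Subsingleton.elim g 0]
  obtain ⟨e, he⟩ := exists_ne (0 : X)
  obtain ⟨E, hE⟩ := SeparatingDual.exists_eq_one (R := ℝ) he
  obtain ⟨g, y, K, R, hg, hy, hge, hgy, hgy'⟩ := exists_triangular_of_not_isReflexiveSpace hX e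
  -- The projection onto `ker E` along `e`.
  let P : X →L[ℝ] X := ContinuousLinearMap.id ℝ X - E.smulRight e
  have hP : ∀ x, P x = x - E x • e := fun x => rfl
  have hPe : P e = 0 := by simp [hP, hE]
  have hEP : ∀ x, E (P x) = 0 := fun x => by simp [hP, hE]
  have hgP : ∀ m x, g m (P x) = g m x := fun m x => by simp [hP, hge]
  have hK : 0 ≤ K := (norm_nonneg _).trans (hg 0)
  have hR : 0 ≤ R := (norm_nonneg _).trans (hy 0)
  let a : ℕ → ℝ := fun m => 1 - 1 / ((m : ℝ) + 2)
  have ha0 : ∀ m, 0 < a m := fun m => by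
    have : 1 / ((m : ℝ) + 2) < 1 := by
      rw [div_lt_one (by positivity)]
      linarith [m.cast_nonneg (α := ℝ)]
    simp only [a]; linarith
  have ha1 : ∀ m, a m < 1 := fun m => by
    have : 0 < 1 / ((m : ℝ) + 2) := by positivity
    simp only [a]; linarith
  have hamono : ∀ {m n}, m ≤ n → a m ≤ a n := fun {m n} hmn => by
    simp only [a]; gcongr
  have halim : Tendsto a atTop (𝓝 1) := by
    have h1 : Tendsto (fun m : ℕ => (m : ℝ) + 2) atTop atTop :=
      tendsto_atTop_add_const_right _ _ tendsto_natCast_atTop_atTop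
    simpa [a] using h1.inv_tendsto_atTop.const_sub 1
  -- `f m (u n)` tends to `(a m + 1) / 2` in `n` and to one in the iterated limit, although every
  -- functional supporting the norm at `e` takes the value `1 / 2` at each `u n`.
  let f : ℕ → StrongDual ℝ X := fun m => a m • E + g m
  have hf : ∀ m x, f m x = a m * E x + g m x := fun m x => rfl
  have hfe : ∀ m, f m e = a m := fun m => by simp [hf, hE, hge]
  let C : ℝ := ‖E‖ + K + 1
  have hC : 0 < C := by positivity
  have hfC : ∀ m x, |f m x| ≤ (C.toNNReal • normSeminorm ℝ X) x := fun m x => by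
    have h1 : (C.toNNReal • normSeminorm ℝ X) x = C * ‖x‖ := by
      simp [NNReal.smul_def, hC.le]
    have h2 : |E x| ≤ ‖E‖ * ‖x‖ := E.le_opNorm x
    have h3 : |g m x| ≤ K * ‖x‖ := (g m).le_of_opNorm_le (hg m) x
    rw [h1, hf]
    calc |a m * E x + g m x| ≤ |a m * E x| + |g m x| := abs_add_le _ _
      _ = a m * |E x| + |g m x| := by rw [abs_mul, abs_of_pos (ha0 m)]
      _ ≤ 1 * (‖E‖ * ‖x‖) + K * ‖x‖ := by gcongr; exact (ha1 m).le
      _ ≤ C * ‖x‖ := by simp only [C]; nlinarith [norm_nonneg x]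
  let ν : Seminorm ℝ X := supSeminorm f
  have hνf : ∀ m x, |f m x| ≤ ν x := abs_le_supSeminorm hfC
  have hν : ∀ x, ν x ≤ C * ‖x‖ := fun x => by
    refine (supSeminorm_le hfC (apply_nonneg _ x) fun i => hfC i x).trans_eq ?_
    simp [NNReal.smul_def, hC.le]
  have hνe : ν e = 1 := by
    refine le_antisymm (supSeminorm_le hfC zero_le_one fun m => ?_) ?_
    · rw [hfe, abs_of_pos (ha0 m)]; exact (ha1 m).le
    · refine le_of_tendsto halim (.of_forall fun m => ?_)
      simpa [hfe, abs_of_pos (ha0 m)] using hνf m e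
  -- Only finitely many `f m` see `P (y n)`, and these take values less than one at `e`.
  have hτy : ∀ n, ∀ h ∈ supportSet ν e, h (P (y n)) = 0 := fun n h hh => by
    set s : ℝ := 1 - a n with hs
    have hs0 : 0 < s := sub_pos.2 (ha1 n)
    have hbd : ∀ t : ℝ, |t| = s → ν (e + t • P (y n)) ≤ 1 := fun t ht => by
      refine supSeminorm_le hfC zero_le_one fun m => ?_
      rw [map_add, hfe, map_smul, hf, hEP, hgP, mul_zero, zero_add, smul_eq_mul]
      rcases le_or_gt m n with hmn | hmn
      · rw [hgy m n hmn, mul_one]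
        refine (abs_add_le _ _).trans ?_
        rw [ht, abs_of_pos (ha0 m), hs]
        linarith [hamono hmn]
      · rw [hgy' m n hmn, mul_zero, add_zero, abs_of_pos (ha0 m)]
        exact (ha1 m).le
    have h1 := (le_abs_self _).trans ((hh.2 _).trans (hbd s (abs_of_pos hs0)))
    have h2 := (le_abs_self _).trans ((hh.2 _).trans (hbd (-s) (by rw [abs_neg, abs_of_pos hs0])))
    rw [map_add, map_smul, hh.1, smul_eq_mul] at h1 h2
    refine le_antisymm ?_ ?_
    · exact nonpos_of_mul_nonpos_right (by linarith) hs0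
    · exact nonneg_of_mul_nonneg_right (by linarith : 0 ≤ s * h (P (y n))) hs0
  -- The weight of the transversal seminorm is so small that the vectors `P (y n)` have `ρ ≤ 1`.
  let B : ℝ := ‖P‖ * R + 1
  have hB : 0 < B := by positivity
  let ρ : Seminorm ℝ X := B⁻¹.toNNReal • (normSeminorm ℝ X).comp P.toLinearMap
  have hρ : ∀ x, ρ x = B⁻¹ * ‖P x‖ := fun x => by
    simp [ρ, NNReal.smul_def, hB.le]
  have hρe : ρ e = 0 := by rw [hρ, hPe, norm_zero, mul_zero]
  have hρE : ∀ x, ‖x - E x • e‖ ≤ B * ρ x := fun x => by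
    rw [hρ, hP, mul_inv_cancel_left₀ hB.ne']
  have hρy : ∀ n, ρ (P (y n)) ≤ 1 := fun n => by
    have hPP : P (P (y n)) = P (y n) := by rw [hP (P (y n)), hEP, zero_smul, sub_zero]
    rw [hρ, hPP, inv_mul_le_iff₀ hB, mul_one]
    calc ‖P (y n)‖ ≤ ‖P‖ * ‖y n‖ := P.le_opNorm _
      _ ≤ ‖P‖ * R := by gcongr; exact hy n
      _ ≤ B := (lt_add_one _).le
  let p := exposingNorm ν ρ e
  have hp : IsEquivalentNorm p := by
    refine exposingNorm_isEquivalentNorm (E := E) (D := B⁻¹ * (‖P‖ + 1)) hC (by positivity) hB hνe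
      hν (fun x => ?_) hρE
    rw [hρ, mul_assoc]
    gcongr
    exact (P.le_opNorm x).trans (by gcongr; linarith)
  refine ⟨p, e, hp, isNSE_exposingNorm hp hνe hρe hρE, fun halur => ?_⟩
  let u : ℕ → X := fun n => (1 / 2 : ℝ) • (e + P (y n))
  have hEu : ∀ n, E (u n) = 1 / 2 := fun n => by simp [u, hE, hEP]
  have hfu : ∀ m n, m ≤ n → f m (u n) = (a m + 1) / 2 := fun m n hmn => by
    rw [map_smul, map_add, hfe, hf, hEP, hgP, hgy m n hmn, smul_eq_mul]; ring
  have hfu' : ∀ m n, n < m → f m (u n) = a m / 2 := fun m n hmn => by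
    rw [map_smul, map_add, hfe, hf, hEP, hgP, hgy' m n hmn, smul_eq_mul]; ring
  have hu : ∀ n, p (u n) ≤ 1 := fun n => by
    refine (exposingNorm_le_iff zero_le_one).2 ⟨supSeminorm_le hfC zero_le_one fun m => ?_, ?_⟩
    · rcases le_or_gt m n with hmn | hmn
      · rw [hfu m n hmn, abs_le]
        constructor <;> linarith [ha0 m, ha1 m]
      · rw [hfu' m n hmn, abs_le]
        constructor <;> linarith [ha0 m, ha1 m]
    · have h1 : supportSeminorm ν e (u n) ≤ 1 / 2 :=
        supportSeminorm_le_of_forall (by norm_num) fun h hh => by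
          rw [map_smul, map_add, hh.1, hτy n h hh]
          norm_num
      have h2 : ρ (u n) ≤ 1 / 2 := by
        rw [map_smul_eq_mul]
        have := map_add_le_add ρ e (P (y n))
        rw [hρe, zero_add] at this
        norm_num
        linarith [hρy n]
      nlinarith [apply_nonneg (supportSeminorm ν e) (u n), apply_nonneg ρ (u n)]
  have hu0 : ∀ n, p (u n) ≠ 0 := fun n h0 => by
    have := hEu n
    rw [hp.eq_zero h0, map_zero] at this
    norm_num at this
  have hf1 : ∀ m, dualNorm p (f m) ≤ 1 := fun m =>
    dualNorm_le fun x hx => (hνf m x).trans ((le_exposingNorm x).trans hx)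
  obtain ⟨hconv, hpu⟩ := halur.tendsto_of_tendsto_iterated hp (β := fun m => (a m + 1) / 2)
    hu hu0 hf1 (fun m => (hfe m).symm ▸ ha0 m) (by simpa only [hfe] using halim)
    (fun m => tendsto_const_nhds.congr' (by
      filter_upwards [eventually_ge_atTop m] with n hn
      exact (hfu m n hn).symm))
    (by simpa using (halim.add_const 1).div_const 2)
  -- `E` is `p`-continuous, equals one at `e`, and tends to one half along the normalized `u n`.
  obtain ⟨L, -, hL⟩ := hp.exists_abs_le E
  have h1 : Tendsto (fun n => |(p (u n))⁻¹ * (1 / 2) - 1|) atTop (𝓝 0) := by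
    refine tendsto_of_tendsto_of_tendsto_of_le_of_le tendsto_const_nhds
      (by simpa using hconv.const_mul L) (fun n => abs_nonneg _) fun n => ?_
    have := hL ((p (u n))⁻¹ • u n - e)
    rwa [map_sub, map_smul, hEu, hE, smul_eq_mul] at this
  have h2 := tendsto_nhds_unique h1
    ((((hpu.inv₀ one_ne_zero).mul_const (1 / 2)).sub_const 1).abs)
  norm_num at h2

end Nonreflexive

theorem theoremA {X : Type*} [NormedAddCommGroup X] [NormedSpace ℝ X] [CompleteSpace X] :
    IsReflexiveSpace X ↔
      ∀ p : Seminorm ℝ X, IsEquivalentNorm p → {x : X | IsALUR p x} = {x : X | IsNSE p x} := by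
  refine ⟨fun hX p hp => Set.ext fun x => ⟨IsALUR.isNSE hp, hX.isALUR hp⟩, fun h => ?_⟩
  by_contra hX
  obtain ⟨p, e, hp, hnse, halur⟩ := exists_isNSE_not_isALUR hX
  have hmem : e ∈ {x : X | IsALUR p x} := h p hp ▸ hnse
  exact halur hmem
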